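/- Let $k$ be a field, $S=k[x_1,\dots,x_n]$, and let $A\subseteq\mathbb Z^n$ be an arbitrary subset. A subset $B\subseteq A$ is strongly neighborly if it is nonempty, has a componentwise join $\bigvee B\in\mathbb Z^n$, and the only nonempty $B'\subseteq A$ with $\bigvee B'=\bigvee B$ is $B'=B$. Such sets are finite and form a simplicial complex $N(A)$, the Scarf complex of $A$. The algebraic Scarf complex $\mathcal F_{N(A)}$ is the Taylor complex supported on $N(A)$: $\mathcal F_i=\bigoplus_{\sigma\in N(A),\,|\sigma|=i+1}S\,e_\sigma$, and for $\sigma=\{\alpha_0<\dots<\alpha_i\}$ (lexicographic order), $i\ge 1$, $$d(e_\sigma)=\sum_{j=0}^{i}(-1)^j\,x^{\bigvee\sigma-\bigvee(\sigma\setminus\alpha_j)}\,e_{\sigma\setminus\alpha_j}.$$ For real $t>1$ put $E_t(\alpha)=(t^{\alpha_1},\dots,t^{\alpha_n})$ and $\mathcal P_t(A)=\mathbb R^n_{\ge0}+\operatorname{conv}(E_t(A))$. The hull complex $\operatorname{hull}_t(A)$ consists of the nonempty finite $F\subseteq A$ such that the polytope $\operatorname{conv}(E_t(F))$ is a face of $\mathcal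 P_t(A)$; the cell $F$ has dimension $\dim\operatorname{conv}(E_t(F))$ and label $\bigvee F$. Choose an orientation of every cell of positive dimension (points are oriented positively) and let $\varepsilon(F,G)=\pm1$ be the resulting incidence number of a cell $F$ and a facet $G$ of $F$ (outward vector first). The cellular free complex of $\operatorname{hull}_t(A)$ has in degree $i$ the free $S$-module on the $i$-dimensional cells, with $d(e_F)=\sum_{G}\varepsilon(F,G)\,x^{\bigvee F-\bigvee G}e_G$, the sum over the facets $G$ of $F$. **Theorem.** Let $t>(n+1)!$. Then: 1. For every $\sigma\in N(A)$ the points $E_t(\alpha)$, $\alpha\in\sigma$, are affinely independent, and the simplex $\operatorname{conv}(E_t(\sigma))$ is a face of $\mathcal P_t(A)$, cut out by a supporting hyperplane or equal to $\mathcal P_t(A)$; so $\sigma$ is a cell of $\operatorname{hull}_t(A)$. Moreover every cell of $\operatorname{hull}_t(A)$ that is contained in the cell $\operatorname{conv}(E_t(\sigma))$ belongs to $N(A)$, so $N(A)$ is a subcomplex of $\operatorname{hull}_t(A)$. 2. For every choice of orientations, $\mathcal F_{N(A)}$ is isomorphic to a subcomplex of the cellular free complex of $\operatorname{hull}_t(A)$,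 by an isomorphism, compatible with the differentials, that sends each $e_\sigma$ to $\pm e_F$, where $F=\sigma$ is regarded as a cell of $\operatorname{hull}_t(A)$. -/

import Mathlib

open scoped Pointwise

/-- `B ⊆ A` is strongly neighborly in `A`: it has a join in `ℤⁿ`, and no other subset of `A` has
the same join (joins are taken of nonempty sets). Such a set is automatically finite. -/
def StronglyNeighborly {n : ℕ} (A B : Set (Fin n → ℤ)) : Prop :=
  B ⊆ A ∧ B.Nonempty ∧ ∃ m : Fin n → ℤ, IsLUB B m ∧
    ∀ B' : Set (Fin n → ℤ), B' ⊆ A → B'.Nonempty → IsLUB B' m → B' = B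

theorem StronglyNeighborly.subset {n : ℕ} {A : Set (Fin n → ℤ)} {B C : Finset (Fin n → ℤ)}
    (hB : StronglyNeighborly A (B : Set (Fin n → ℤ))) (hCB : C ⊆ B) (hC : C.Nonempty) :
    StronglyNeighborly A (C : Set (Fin n → ℤ)) := by
  obtain ⟨hBA, -, m, hm, huniq⟩ := hB
  have hCB' : (C : Set (Fin n → ℤ)) ⊆ B := by exact_mod_cast hCB
  refine ⟨hCB'.trans hBA, by exact_mod_cast hC, C.sup' hC id, ?_, ?_⟩
  · exact Finset.isLUB_sup' hC
  have hlub : IsLUB (C : Set (Fin n → ℤ)) (C.sup' hC id) := by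
    exact Finset.isLUB_sup' hC
  intro C' hC'A hC'ne hC'
  have hub : upperBounds C' = upperBounds (C : Set (Fin n → ℤ)) := by
    rw [hC'.upperBounds_eq, hlub.upperBounds_eq]
  have h1 : C' ∪ ((B : Set (Fin n → ℤ)) \ C) = B := by
    refine huniq _ (Set.union_subset hC'A (Set.sdiff_subset.trans hBA)) (hC'ne.inl) ?_
    have : upperBounds (C' ∪ ((B : Set (Fin n → ℤ)) \ C)) = upperBounds (B : Set (Fin n → ℤ)) := by
      rw [upperBounds_union, hub, ← upperBounds_union, Set.union_sdiff_cancel hCB']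
    unfold IsLUB
    rw [this]
    exact hm
  refine Set.Subset.antisymm ?_ ?_
  · intro x hx
    by_contra hxC
    have hxB : x ∈ (B : Set (Fin n → ℤ)) := h1 ▸ Or.inl hx
    have hCx : (C : Set (Fin n → ℤ)) ⊆ (B : Set (Fin n → ℤ)) \ {x} := fun y hy =>
      ⟨hCB' hy, fun h => hxC (by rw [Set.mem_singleton_iff] at h; exact h ▸ hy)⟩
    have h2 : (B : Set (Fin n → ℤ)) \ {x} = B := by
      refine huniq _ (Set.sdiff_subset.trans hBA)
        ((by exact_mod_cast hC : (C : Set (Fin n → ℤ)).Nonempty).mono hCx) ?_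
      have : upperBounds ((B : Set (Fin n → ℤ)) \ {x}) = upperBounds (B : Set (Fin n → ℤ)) := by
        refine Set.Subset.antisymm ?_ (upperBounds_mono_set Set.sdiff_subset)
        intro u hu y hy
        by_cases hyx : y = x
        · subst hyx
          have hu' : u ∈ upperBounds C' := hub ▸ upperBounds_mono_set hCx hu
          exact hu' hx
        · exact hu ⟨hy, hyx⟩
      unfold IsLUB
      rw [this]
      exact hm
    have : x ∈ (B : Set (Fin n → ℤ)) \ {x} := h2.symm ▸ hxB
    exact this.2 rfl
  · intro x hx
    have hxB : x ∈ C' ∪ ((B : Set (Fin n → ℤ)) \ C) := h1.symm ▸ hCB' hx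
    rcases hxB with h | h
    · exact h
    · exact absurd hx h.2

/-- The Scarf complex `N(A)`: the simplicial complex of the strongly neighborly sets of `A`. -/
def scarfComplex {n : ℕ} (A : Set (Fin n → ℤ)) : PreAbstractSimplicialComplex (Fin n → ℤ) where
  faces := {σ | StronglyNeighborly A (σ : Set (Fin n → ℤ))}
  isRelLowerSet_faces := fun _ hσ =>
    ⟨by exact_mod_cast hσ.2.1, fun _ hτσ hτ => StronglyNeighborly.subset hσ hτσ hτ⟩

/-- The label of a cell with vertex set `F`: the join `⋁ F` (with value `0` when `F = ∅`, which
never is a cell). -/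
def cellLabel {n : ℕ} (F : Finset (Fin n → ℤ)) : Fin n → ℤ :=
  fun j => if h : F.Nonempty then F.sup' h (fun α => α j) else 0

theorem cellLabel_mono {n : ℕ} {F G : Finset (Fin n → ℤ)} (hGF : G ⊆ F) (hG : G.Nonempty)
    (j : Fin n) : cellLabel G j ≤ cellLabel F j := by
  unfold cellLabel
  rw [dif_pos hG, dif_pos (hG.mono hGF)]
  exact Finset.sup'_mono _ hGF hG

/-- The exponent vector `⋁ F - ⋁ G ∈ ℕⁿ`, for cells `G ⊆ F`. -/
noncomputable def labelDiff {n : ℕ} (F G : Finset (Fin n → ℤ)) : Fin n →₀ ℕ :=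
  Finsupp.equivFunOnFinite.symm fun j => (cellLabel F j - cellLabel G j).toNat

theorem labelDiff_add {n : ℕ} {F G H : Finset (Fin n → ℤ)} (hGF : G ⊆ F) (hHG : H ⊆ G)
    (hH : H.Nonempty) : labelDiff F G + labelDiff G H = labelDiff F H := by
  ext j
  have h1 := cellLabel_mono hGF (hH.mono hHG) j
  have h2 := cellLabel_mono hHG hH j
  simp only [labelDiff, Finsupp.add_apply, Finsupp.equivFunOnFinite_symm_apply_apply]
  omega

/-- The `i`-faces of a simplicial complex on vertices in `ℤⁿ`. -/
abbrev SimplexOfDim {n : ℕ} (Δ : PreAbstractSimplicialComplex (Fin n → ℤ)) (i : ℕ) : Type :=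
  {σ : Finset (Fin n → ℤ) // σ ∈ Δ.faces ∧ σ.card = i + 1}

/-- The face `σ ∖ {α}` of a face `σ` of dimension `i + 1`. -/
def SimplexOfDim.erase {n : ℕ} {Δ : PreAbstractSimplicialComplex (Fin n → ℤ)} {i : ℕ}
    (σ : SimplexOfDim Δ (i + 1)) (α : {α // α ∈ σ.1}) : SimplexOfDim Δ i :=
  ⟨σ.1.erase α.1, by
    have hcard : (σ.1.erase α.1).card = i + 1 := by
      rw [Finset.card_erase_of_mem α.2, σ.2.2]; rfl
    exact ⟨(Δ.isRelLowerSet_faces σ.2.1).2 (Finset.erase_subset _ _)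
      (Finset.card_pos.1 (by omega)), hcard⟩⟩

/-- The degree `i` part `⨁_{σ ∈ Δ_i} S e_σ` of the Taylor complex supported on `Δ`, where
`S = k[x₁, …, xₙ]`. -/
abbrev TaylorModule {n : ℕ} (k : Type*) [Field k]
    (Δ : PreAbstractSimplicialComplex (Fin n → ℤ)) (i : ℕ) :=
  SimplexOfDim Δ i →₀ MvPolynomial (Fin n) k

open Classical in
/-- The position (counted from `0`) of `α` in `σ`, when the elements of `σ` are listed in
lexicographic order. -/
noncomputable def position {n : ℕ} (σ : Finset (Fin n → ℤ)) (α : Fin n → ℤ) : ℕ :=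
  (σ.filter fun β => toLex β < toLex α).card

/-- The differential of the Taylor complex supported on `Δ`: for `σ = {α₀ < ⋯ < α_{i+1}}`,
`d e_σ = ∑_j (-1)^j x^{⋁σ - ⋁(σ∖α_j)} e_{σ∖α_j}`. -/
noncomputable def taylorD {n : ℕ} (k : Type*) [Field k]
    (Δ : PreAbstractSimplicialComplex (Fin n → ℤ)) (i : ℕ) :
    TaylorModule k Δ (i + 1) →ₗ[MvPolynomial (Fin n) k] TaylorModule k Δ i :=
  Finsupp.linearCombination (MvPolynomial (Fin n) k) fun σ : SimplexOfDim Δ (i + 1) =>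
    ∑ α ∈ σ.1.attach, Finsupp.single (σ.erase α)
      (MvPolynomial.monomial (labelDiff σ.1 (σ.1.erase α.1)) ((-1 : k) ^ position σ.1 α.1))

open Classical in
theorem position_erase_of_lt {n : ℕ} {σ : Finset (Fin n → ℤ)} {α β : Fin n → ℤ}
    (h : toLex α < toLex β) (hα : α ∈ σ) :
    position σ β = position (σ.erase α) β + 1 ∧ position (σ.erase β) α = position σ α := by
  constructor
  · unfold position
    have hmem : α ∈ σ.filter fun γ => toLex γ < toLex β := by simp [hα, h]
    rw [Finset.filter_erase, Finset.card_erase_add_one hmem]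
  · unfold position
    rw [Finset.filter_erase, Finset.erase_eq_of_notMem]
    intro hc
    exact absurd (Finset.mem_filter.1 hc).2 (lt_asymm h)

theorem sign_position {n : ℕ} {k : Type*} [Field k] {σ : Finset (Fin n → ℤ)} {α β : Fin n → ℤ}
    (hα : α ∈ σ) (hβ : β ∈ σ) (hne : α ≠ β) :
    (-1 : k) ^ position σ α * (-1) ^ position (σ.erase α) β +
      (-1) ^ position σ β * (-1) ^ position (σ.erase β) α = 0 := by
  rcases lt_or_gt_of_ne (fun h => hne (toLex.injective h) : toLex α ≠ toLex β) with h | h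
  · obtain ⟨h1, h2⟩ := position_erase_of_lt h hα
    rw [h1, h2]; ring
  · obtain ⟨h1, h2⟩ := position_erase_of_lt h hβ
    rw [h1, h2]; ring

/-- The Taylor complex supported on `Δ` is a complex. -/
theorem taylorD_comp_taylorD {n : ℕ} (k : Type*) [Field k]
    (Δ : PreAbstractSimplicialComplex (Fin n → ℤ)) (i : ℕ) :
    (taylorD k Δ i).comp (taylorD k Δ (i + 1)) = 0 := by
  refine Finsupp.lhom_ext' fun σ => LinearMap.ext_ring ?_
  simp only [taylorD, LinearMap.comp_apply, Finsupp.lsingle_apply,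
    Finsupp.linearCombination_single, one_smul, map_sum, LinearMap.zero_apply,
    Finset.smul_sum, Finsupp.smul_single, smul_eq_mul, MvPolynomial.monomial_mul]
  rw [Finset.sum_sigma']
  refine Finset.sum_involution
    (fun p _ => ⟨⟨p.2.1, Finset.mem_of_mem_erase p.2.2⟩,
      ⟨p.1.1, Finset.mem_erase.2 ⟨fun h => (Finset.mem_erase.1 p.2.2).1 h.symm, p.1.2⟩⟩⟩)
    ?_ ?_ ?_ ?_
  · rintro ⟨⟨α, hα⟩, ⟨β, hβ⟩⟩ -
    have hβ' : β ∈ σ.1.erase α := hβ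
    have hne : α ≠ β := fun h => (Finset.mem_erase.1 hβ').1 h.symm
    have hβσ : β ∈ σ.1 := Finset.mem_of_mem_erase hβ'
    have hcell : (σ.erase ⟨β, hβσ⟩).erase ⟨α, Finset.mem_erase.2 ⟨hne, hα⟩⟩
        = (σ.erase ⟨α, hα⟩).erase ⟨β, hβ⟩ := Subtype.ext (Finset.erase_right_comm)
    have hH : ((σ.1.erase α).erase β).Nonempty :=
      (Δ.isRelLowerSet_faces ((σ.erase ⟨α, hα⟩).erase ⟨β, hβ⟩).2.1).1
    have hH' : ((σ.1.erase β).erase α).Nonempty := by rwa [Finset.erase_right_comm]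
    dsimp only
    rw [hcell, ← Finsupp.single_add]
    simp only [SimplexOfDim.erase]
    rw [labelDiff_add (Finset.erase_subset _ _) (Finset.erase_subset _ _) hH,
      labelDiff_add (Finset.erase_subset _ _) (Finset.erase_subset _ _) hH',
      Finset.erase_right_comm (a := β), ← map_add, sign_position hα hβσ hne, map_zero,
      Finsupp.single_zero]
  · rintro ⟨⟨α, hα⟩, ⟨β, hβ⟩⟩ - - h
    have h1 := congrArg (fun p => p.1.1) h
    exact (Finset.mem_erase.1 hβ).1 h1
  · intro p _
    exact Finset.mem_sigma.2 ⟨Finset.mem_attach _ _, Finset.mem_attach _ _⟩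
  · rintro ⟨⟨α, hα⟩, ⟨β, hβ⟩⟩ -
    rfl

/-- `E_t(α) = (t^{α₁}, …, t^{αₙ})`. -/
noncomputable def expPoint {n : ℕ} (t : ℝ) (α : Fin n → ℤ) : Fin n → ℝ := fun j => t ^ α j

/-- `𝒫_t(A) = ℝⁿ_{≥0} + conv (E_t(A))`. -/
def hullPolyhedron {n : ℕ} (t : ℝ) (A : Set (Fin n → ℤ)) : Set (Fin n → ℝ) :=
  Set.Ici 0 + convexHull ℝ (expPoint t '' A)

/-- `conv (E_t(F))`. -/
def cellBody {n : ℕ} (t : ℝ) (F : Finset (Fin n → ℤ)) : Set (Fin n → ℝ) :=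
  convexHull ℝ (expPoint t '' (F : Set (Fin n → ℤ)))

/-- The cells of `hull_t(A)`: the nonempty finite `F ⊆ A` for which the polytope `conv (E_t(F))`
is a face (a convex extreme subset) of `𝒫_t(A)`. -/
def hullCells {n : ℕ} (t : ℝ) (A : Set (Fin n → ℤ)) : Set (Finset (Fin n → ℤ)) :=
  {F | F.Nonempty ∧ (F : Set (Fin n → ℤ)) ⊆ A ∧ IsExtreme ℝ (hullPolyhedron t A) (cellBody t F)}

/-- The direction space of the affine hull of `E_t(F)`. -/
noncomputable def cellSpan {n : ℕ} (t : ℝ) (F : Finset (Fin n → ℤ)) : Submodule ℝ (Fin n → ℝ) :=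
  vectorSpan ℝ (expPoint t '' (F : Set (Fin n → ℤ)))

/-- The dimension of the polytope `conv (E_t(F))`. -/
noncomputable def cellDim {n : ℕ} (t : ℝ) (F : Finset (Fin n → ℤ)) : ℕ :=
  Module.finrank ℝ (cellSpan t F)

/-- A choice of an orientation of every polytope `conv (E_t(F))`, given by an ordered basis of
its direction space (points are oriented positively, by the empty basis). -/
abbrev CellOrientation (n : ℕ) (t : ℝ) :=
  (F : Finset (Fin n → ℤ)) → Module.Basis (Fin (cellDim t F)) ℝ (cellSpan t F)

noncomputable instance (n : ℕ) (t : ℝ) : Inhabited (CellOrientation n t) :=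
  ⟨fun F => Module.finBasis ℝ (cellSpan t F)⟩

/-- The barycenter of the points `E_t(α)`, `α ∈ F`. -/
noncomputable def barycenter {n : ℕ} (t : ℝ) (F : Finset (Fin n → ℤ)) : Fin n → ℝ :=
  (F.card : ℝ)⁻¹ • ∑ α ∈ F, expPoint t α

/-- The incidence number of a cell `F` and a facet `G` of `F`: it is `1` if the frame
(outward vector at `G`, oriented basis of `G`) of the direction space of `F` is positively
oriented, and `-1` otherwise. Here the outward vector points from the barycenter of `F` to that of
`G`. Two bases `b`, `c` of the same subspace of `ℝⁿ` have the same orientation if and only if the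
matrix of the dot products `b_i ⬝ c_j` has positive determinant. -/
noncomputable def incidence {n : ℕ} {t : ℝ} (o : CellOrientation n t)
    (F G : Finset (Fin n → ℤ)) (h : cellDim t F = cellDim t G + 1) : SignType :=
  SignType.sign (Matrix.det (Matrix.of fun i j : Fin (cellDim t G + 1) =>
    (o F (Fin.cast h.symm i) : Fin n → ℝ) ⬝ᵥ
      (Fin.cons (barycenter t G - barycenter t F) (fun l => (o G l : Fin n → ℝ)) :
        Fin (cellDim t G + 1) → Fin n → ℝ) j))

/-- The `i`-dimensional cells of `hull_t(A)`. -/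
abbrev HullCellOfDim {n : ℕ} (t : ℝ) (A : Set (Fin n → ℤ)) (i : ℕ) : Type :=
  {F : Finset (Fin n → ℤ) // F ∈ hullCells t A ∧ cellDim t F = i}

/-- The degree `i` part of the cellular free complex supported on `hull_t(A)`: the free
`S`-module on the `i`-dimensional cells. -/
abbrev HullModule {n : ℕ} (k : Type*) [Field k] (t : ℝ) (A : Set (Fin n → ℤ)) (i : ℕ) :=
  HullCellOfDim t A i →₀ MvPolynomial (Fin n) k

open Classical in
/-- The differential of the cellular free complex supported on `hull_t(A)`:
`d e_F = ∑_G ε(F, G) x^{⋁F - ⋁G} e_G`, the sum being over the facets `G` of the cell `F`. -/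
noncomputable def hullD {n : ℕ} (k : Type*) [Field k] {t : ℝ} (A : Set (Fin n → ℤ))
    (o : CellOrientation n t) (i : ℕ) :
    HullModule k t A (i + 1) →ₗ[MvPolynomial (Fin n) k] HullModule k t A i :=
  Finsupp.linearCombination (MvPolynomial (Fin n) k) fun F : HullCellOfDim t A (i + 1) =>
    ∑ G ∈ F.1.powerset, if hG : G ∈ hullCells t A ∧ cellDim t G = i then
      Finsupp.single (⟨G, hG⟩ : HullCellOfDim t A i)
        (MvPolynomial.monomial (labelDiff F.1 G)
          (((incidence o F.1 G (by rw [F.2.2, hG.2]) : SignType) : ℤ) : k))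
    else 0

/-!
If `σ` is strongly neighborly and `n > 0`, every `α ∈ σ` has a coordinate `J α` in which it
strictly exceeds all other elements of `σ`, for otherwise `σ ∖ {α}` would have the same join. In
the coordinates `J α` the points `E_t(α)` therefore form a diagonally dominant matrix, which gives their affine
independence. After rescaling the join `⋁ σ` to `(1, …, 1)`, the same dominance lets one solve
`w ⬝ E_t(α) = 1` for all `α ∈ σ` with all coefficients of `w` larger than `1 / t`
(`exists_weight_of_dominant`). An element of `A` outside `σ` is not below `⋁ σ`, so one of its
rescaled coordinates is at least `t`, and `w` is larger than `1` on it. Since `w` is positive, it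
exposes `conv (E_t(σ))` as a face of `𝒫_t(A)`, and this face contains no `E_t(α)` with
`α ∈ A ∖ σ` (`StronglyNeighborly.exists_weight`); hence cells inside `conv (E_t(σ))` are subsets of
`σ`, and these are strongly neighborly again.

For the complexes, `e_σ` is sent to `± e_F`, with the sign comparing the given orientation of the
simplex to the one defined by the lexicographic order of its vertices. That this commutes with the
differentials is the identity `incidence_mul_simplexSign`: for the lexicographic orientations, the
incidence number of `σ` and `σ ∖ {α_j}` is `(-1) ^ j`. All orientations are compared through the
alternating forms `x ↦ det (b_i ⬝ x_j)` (`frameForm`); the sign `(-1) ^ j` is that of the cyclic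
permutation moving `α_j` to the front in a determinant of homogeneous coordinates.
-/

/-! ### Strongly neighborly sets -/

/-- Otherwise `α` could be removed from `σ` without changing the join. -/
theorem StronglyNeighborly.exists_dominant_coord {n : ℕ} [NeZero n] {A : Set (Fin n → ℤ)}
    {σ : Finset (Fin n → ℤ)} (hσ : StronglyNeighborly A (σ : Set (Fin n → ℤ)))
    {α : Fin n → ℤ} (hα : α ∈ σ) : ∃ j, ∀ β ∈ σ, β ≠ α → β j < α j := by
  obtain ⟨hσA, -, m, hm, huniq⟩ := hσ
  by_contra! hcon
  have hne : ((σ : Set (Fin n → ℤ)) \ {α}).Nonempty := by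
    obtain ⟨β, hβ, hβα, -⟩ := hcon 0
    exact ⟨β, hβ, hβα⟩
  have hlub : IsLUB ((σ : Set (Fin n → ℤ)) \ {α}) m := by
    refine ⟨fun β hβ => hm.1 hβ.1, fun u hu => hm.2 fun β hβ => ?_⟩
    by_cases hβα : β = α
    · intro j
      obtain ⟨γ, hγ, hγα, hle⟩ := hcon j
      exact hβα ▸ hle.trans (hu ⟨hγ, hγα⟩ j)
    · exact hu ⟨hβ, hβα⟩
  have h := huniq _ (Set.sdiff_subset.trans hσA) hne hlub
  exact (h.symm ▸ hα : α ∈ (σ : Set (Fin n → ℤ)) \ {α}).2 rfl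

theorem StronglyNeighborly.exists_dominant_coords {n : ℕ} [NeZero n] {A : Set (Fin n → ℤ)}
    {σ : Finset (Fin n → ℤ)} (hσ : StronglyNeighborly A (σ : Set (Fin n → ℤ))) :
    ∃ J : (Fin n → ℤ) → Fin n, (∀ α ∈ σ, ∀ β ∈ σ, β ≠ α → β (J α) < α (J α)) ∧
      Function.Injective fun α : σ => J α.1 := by
  choose! J hJ using fun α (hα : α ∈ σ) => hσ.exists_dominant_coord hα
  refine ⟨J, hJ, ?_⟩
  rintro ⟨α, hα⟩ ⟨β, hβ⟩ h
  by_contra hne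
  have hne' : α ≠ β := fun h => hne (Subtype.ext h)
  have h1 := hJ α hα β hβ hne'.symm
  have h2 := hJ β hβ α hα hne'
  simp only at h
  rw [h] at h1
  exact lt_asymm h1 h2

/-- If a set of lattice points has a greatest `j`-th coordinate, its join attains it. -/
theorem IsLUB.apply_eq_of_forall_le {n : ℕ} {B : Set (Fin n → ℤ)} {m α : Fin n → ℤ}
    (hm : IsLUB B m) (hα : α ∈ B) {j : Fin n} (h : ∀ β ∈ B, β j ≤ α j) : α j = m j := by
  refine le_antisymm (hm.1 hα j) ?_
  have hub : Function.update m j (α j) ∈ upperBounds B := by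
    intro β hβ l
    by_cases hl : l = j
    · subst hl; simpa using h β hβ
    · simpa [hl] using hm.1 hβ l
  simpa using hm.2 hub j

/-- A point of `A` below the join of `σ` could be added to `σ` without changing the join. -/
theorem StronglyNeighborly.exists_lt_of_notMem {n : ℕ} {A B : Set (Fin n → ℤ)}
    (hB : StronglyNeighborly A B) {m : Fin n → ℤ} (hm : IsLUB B m) {α : Fin n → ℤ}
    (hα : α ∈ A) (hαB : α ∉ B) : ∃ j, m j < α j := by
  obtain ⟨hBA, hne, m', hm', huniq⟩ := hB
  obtain rfl := hm.unique hm'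
  by_contra! hle
  have hlub : IsLUB (insert α B) m := by
    refine ⟨?_, fun u hu => hm.2 fun β hβ => hu (Or.inr hβ)⟩
    rintro β (rfl | hβ)
    exacts [hle, hm.1 hβ]
  have h := huniq _ (Set.insert_subset hα hBA) (Set.insert_nonempty _ _) hlub
  exact hαB (h ▸ Set.mem_insert α B)

/-! ### The supporting functional -/

/-- The linear system behind the supporting hyperplane. The ansatz `w = 2/t + z`, with `z`
supported on the dominant coordinates `J i`, leads to a diagonally dominant system for `z`, whose
solution is bounded by `2`; the bound is then fed back into the system to show that `z > -1/t`. -/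
theorem exists_weight_of_dominant {ι : Type*} [Fintype ι] [DecidableEq ι] {n : ℕ} {t : ℝ}
    (y : ι → Fin n → ℝ) (J : ι → Fin n) (hJ : Function.Injective J)
    (ht : 2 * (n : ℝ) < t) (ht' : 4 * (n : ℝ) - 3 < t)
    (hy0 : ∀ i j, 0 ≤ y i j) (hy1 : ∀ i j, y i j ≤ 1) (hdiag : ∀ i, y i (J i) = 1)
    (hoff : ∀ i i', i' ≠ i → y i (J i') ≤ 1 / t) :
    ∃ w : Fin n → ℝ, (∀ j, 1 / t < w j) ∧ ∀ i, ∑ j, w j * y i j = 1 := by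
  have ht0 : 0 < t := lt_of_le_of_lt (by positivity) ht
  rcases isEmpty_or_nonempty ι with hι | hι
  · exact ⟨fun _ => 2 / t, fun _ => div_lt_div_of_pos_right one_lt_two ht0, fun i => isEmptyElim i⟩
  have hk : Fintype.card ι ≤ n := by simpa using Fintype.card_le_of_injective J hJ
  have hk1 : 1 ≤ Fintype.card ι := Fintype.card_pos
  -- the sum of the off-diagonal entries of a row, weighted by numbers of size at most `s`
  have hrow : ∀ (z : ι → ℝ) (s : ℝ), 0 ≤ s → (∀ i, |z i| ≤ s) → ∀ i,
      |∑ i' ∈ Finset.univ.erase i, y i (J i') * z i'| ≤ (n - 1) / t * s := by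
    intro z s hs hz i
    calc |∑ i' ∈ Finset.univ.erase i, y i (J i') * z i'|
        ≤ ∑ i' ∈ Finset.univ.erase i, |y i (J i') * z i'| := Finset.abs_sum_le_sum_abs _ _
      _ ≤ ∑ i' ∈ Finset.univ.erase i, 1 / t * s := by
          refine Finset.sum_le_sum fun i' hi' => ?_
          rw [abs_mul, abs_of_nonneg (hy0 _ _)]
          exact mul_le_mul (hoff i i' (Finset.ne_of_mem_erase hi')) (hz i') (abs_nonneg _)
            (by positivity)
      _ = (Fintype.card ι - 1 : ℕ) * (1 / t * s) := by
          rw [Finset.sum_const, Finset.card_erase_of_mem (Finset.mem_univ _), nsmul_eq_mul]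
          rfl
      _ ≤ (n - 1 : ℝ) * (1 / t * s) := by
          refine mul_le_mul_of_nonneg_right ?_ (by positivity)
          rw [Nat.cast_sub hk1, Nat.cast_one]
          exact sub_le_sub_right (by exact_mod_cast hk) 1
      _ = (n - 1) / t * s := by ring
  have hn1 : (1 : ℝ) ≤ n := by exact_mod_cast hk1.trans hk
  have hfrac : (n - 1) / t ≤ 1 / 2 := by
    rw [div_le_div_iff₀ ht0 (by norm_num)]; linarith
  set M : Matrix ι ι ℝ := Matrix.of fun i i' => y i (J i') with hM
  have hdet : M.det ≠ 0 := by
    refine det_ne_zero_of_sum_row_lt_diag fun i => ?_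
    have h := hrow (fun _ => 1) 1 zero_le_one (by simp) i
    have hnn : 0 ≤ ∑ i' ∈ Finset.univ.erase i, y i (J i') :=
      Finset.sum_nonneg fun _ _ => hy0 _ _
    simp only [mul_one, abs_of_nonneg hnn] at h
    simp only [hM, Matrix.of_apply, Real.norm_eq_abs, abs_of_nonneg (hy0 _ _)]
    rw [hdiag]
    linarith
  set b : ι → ℝ := fun i => 1 - 2 / t * ∑ j, y i j with hb
  have hsum0 : ∀ i, 0 ≤ ∑ j, y i j := fun i => Finset.sum_nonneg fun j _ => hy0 i j
  have hsum1 : ∀ i, ∑ j, y i j ≤ n := fun i => by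
    simpa using Finset.sum_le_card_nsmul Finset.univ (y i) 1 fun j _ => hy1 i j
  have hb1 : ∀ i, b i ≤ 1 := fun i => by
    have : 0 ≤ 2 / t * ∑ j, y i j := mul_nonneg (by positivity) (hsum0 i)
    simp only [hb]; linarith
  have hb0 : ∀ i, 1 - 2 * n / t ≤ b i := fun i => by
    have : 2 / t * ∑ j, y i j ≤ 2 / t * n := mul_le_mul_of_nonneg_left (hsum1 i) (by positivity)
    have h2 : 2 / t * n = 2 * n / t := by ring
    simp only [hb]; linarith
  have hnt : 2 * n / t ≤ 1 := (div_le_one ht0).2 ht.le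
  obtain ⟨z, hz⟩ : ∃ z, M.mulVec z = b :=
    ⟨M⁻¹.mulVec b, by rw [Matrix.mulVec_mulVec, Matrix.mul_nonsing_inv _ hdet.isUnit,
      Matrix.one_mulVec]⟩
  have hzi : ∀ i, z i + ∑ i' ∈ Finset.univ.erase i, y i (J i') * z i' = b i := fun i => by
    rw [← hz, Matrix.mulVec, dotProduct, ← Finset.add_sum_erase _ _ (Finset.mem_univ i)]
    simp [hM, hdiag]
  obtain ⟨i₀, hi₀⟩ := Finite.exists_max fun i => |z i|
  have hs : |z i₀| ≤ 2 := by
    have h1 := hrow z _ (abs_nonneg (z i₀)) hi₀ i₀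
    have h2 : |z i₀| ≤ |b i₀| + |∑ i' ∈ Finset.univ.erase i₀, y i₀ (J i') * z i'| := by
      rw [← hzi i₀]
      exact (le_of_eq (by congr 1; ring)).trans (abs_sub (z i₀ + _) _)
    have h3 : |b i₀| ≤ 1 := abs_le.2 ⟨by linarith [hb0 i₀], hb1 i₀⟩
    have h4 := mul_le_mul_of_nonneg_right hfrac (abs_nonneg (z i₀))
    linarith
  have hzlow : ∀ i, -(1 / t) < z i := fun i => by
    have h1 := (abs_le.1 (hrow z 2 zero_le_two (fun i => (hi₀ i).trans hs) i)).2
    have h2 : 1 - 2 * n / t - (n - 1) / t * 2 + 1 / t = (t - (4 * n - 3)) / t := by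
      field_simp; ring
    have h3 : 0 < (t - (4 * n - 3)) / t := div_pos (by linarith) ht0
    linarith [hzi i, hb0 i]
  refine ⟨fun j => 2 / t + Function.extend J z 0 j, fun j => ?_, fun i => ?_⟩
  · have h2 : 2 / t = 1 / t + 1 / t := by ring
    beta_reduce
    by_cases hj : ∃ i, J i = j
    · obtain ⟨i, rfl⟩ := hj
      rw [hJ.extend_apply]
      linarith [hzlow i]
    · rw [Function.extend_apply' _ _ _ hj, Pi.zero_apply, h2]
      have : 0 < 1 / t := by positivity
      linarith
  · have h1 : ∑ i', z i' * y i (J i') = ∑ j, Function.extend J z 0 j * y i j :=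
      Fintype.sum_of_injective J hJ _ _
        (fun j hj => by rw [Function.extend_apply' _ _ _ hj, Pi.zero_apply, zero_mul])
        (fun i' => by rw [hJ.extend_apply])
    have h2 : ∑ i', z i' * y i (J i') = b i := by
      rw [← hz]
      exact Finset.sum_congr rfl fun i' _ => mul_comm _ _
    simp only [add_mul, Finset.sum_add_distrib, ← Finset.mul_sum, ← h1, h2, hb]
    ring

theorem two_mul_le_factorial_succ (n : ℕ) : 2 * n ≤ (n + 1).factorial := by
  induction n with
  | zero => simp
  | succ n ih =>
    rw [Nat.factorial_succ]
    nlinarith [(n + 1).factorial_pos]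

theorem four_mul_le_factorial_succ_add (n : ℕ) : 4 * n ≤ (n + 1).factorial + 3 := by
  rcases n with - | - | n
  · simp
  · simp [Nat.factorial]
  · have := two_mul_le_factorial_succ (n + 1)
    rw [Nat.factorial_succ (n + 1 + 1)]
    nlinarith

/-- The coordinate functional supporting `𝒫_t(A)` along `conv (E_t(σ))`. Its coefficients are
positive, so that it also cuts off the recession cone. -/
theorem StronglyNeighborly.exists_weight {n : ℕ} {A : Set (Fin n → ℤ)} {t : ℝ}
    (ht : ((n + 1).factorial : ℝ) < t)
    {σ : Finset (Fin n → ℤ)} (hσ : StronglyNeighborly A (σ : Set (Fin n → ℤ))) :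
    ∃ (w : Fin n → ℝ) (v : ℝ), (∀ j, 0 < w j) ∧ (∀ α ∈ σ, w ⬝ᵥ expPoint t α = v) ∧
      ∀ α ∈ A, α ∉ σ → v < w ⬝ᵥ expPoint t α := by
  classical
  rcases Nat.eq_zero_or_pos n with rfl | hn
  -- `ℤ⁰` is a single point, so that `σ` exhausts `A`
  · obtain ⟨α, hα⟩ := hσ.2.1
    exact ⟨0, 0, fun j => j.elim0, by simp, fun β _ hβ =>
      absurd (by rwa [Subsingleton.elim β α]) hβ⟩
  have : NeZero n := ⟨hn.ne'⟩
  have ht1 : 1 < t :=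
    lt_of_le_of_lt (by exact_mod_cast (Nat.factorial_pos (n + 1))) ht
  have ht0 : 0 < t := zero_lt_one.trans ht1
  obtain ⟨m, hm⟩ := hσ.2.2.imp fun _ h => h.1
  obtain ⟨J, hJ, hJinj⟩ := hσ.exists_dominant_coords
  have hJm : ∀ α ∈ σ, α (J α) = m (J α) := fun α hα =>
    hm.apply_eq_of_forall_le hα fun β hβ => by
      by_cases h : β = α
      · rw [h]
      · exact (hJ α hα β hβ h).le
  have hle1 : ∀ k : ℤ, k ≤ -1 → t ^ k ≤ 1 / t := fun k hk => by
    rw [one_div, ← zpow_neg_one]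
    exact zpow_le_zpow_right₀ ht1.le hk
  -- the coordinates are rescaled so that the join of `σ` becomes `(1, …, 1)`
  obtain ⟨w, hw, hwσ⟩ := exists_weight_of_dominant (t := t)
    (fun (α : σ) j => t ^ (α.1 j - m j)) (fun α : σ => J α.1) hJinj
    (lt_of_le_of_lt (by exact_mod_cast two_mul_le_factorial_succ n) ht)
    (by
      have h : (4 * n : ℝ) ≤ (n + 1).factorial + 3 := by
        exact_mod_cast four_mul_le_factorial_succ_add n
      linarith)
    (fun _ _ => (zpow_pos ht0 _).le)
    (fun α j => by
      have h : α.1 j - m j ≤ 0 := sub_nonpos.2 (hm.1 α.2 j)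
      simpa using zpow_le_zpow_right₀ ht1.le h)
    (fun α => by simp [hJm α.1 α.2])
    (fun α β hne => hle1 _ (by
      have h1 := hJ β.1 β.2 α.1 α.2 (fun h => hne (Subtype.ext h.symm))
      have h2 := hJm β.1 β.2
      omega))
  have hw0 : ∀ j, 0 < w j := fun j => lt_trans (by positivity) (hw j)
  have hdot : ∀ α : Fin n → ℤ, (fun j => w j * t ^ (-m j)) ⬝ᵥ expPoint t α =
      ∑ j, w j * t ^ (α j - m j) := fun α =>
    Finset.sum_congr rfl fun j _ => by
      simp only [expPoint]
      rw [mul_assoc, ← zpow_add₀ ht0.ne', neg_add_eq_sub]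
  refine ⟨fun j => w j * t ^ (-m j), 1, fun j => mul_pos (hw0 j) (zpow_pos ht0 _),
    fun α hα => by rw [hdot]; exact hwσ ⟨α, hα⟩, fun α hαA hασ => ?_⟩
  obtain ⟨j, hj⟩ := hσ.exists_lt_of_notMem hm hαA (by exact_mod_cast hασ)
  rw [hdot]
  calc 1 < w j * t := by
        have := hw j
        rwa [div_lt_iff₀ ht0] at this
    _ ≤ w j * t ^ (α j - m j) := by
        refine mul_le_mul_of_nonneg_left ?_ (hw0 j).le
        simpa using zpow_le_zpow_right₀ ht1.le (show (1 : ℤ) ≤ α j - m j by omega)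
    _ ≤ ∑ j, w j * t ^ (α j - m j) :=
        Finset.single_le_sum (f := fun j => w j * t ^ (α j - m j))
          (fun j _ => (mul_pos (hw0 j) (zpow_pos ht0 _)).le) (Finset.mem_univ j)

/-! ### Affine independence -/

/-- In the dominant coordinates `J α`, the points `E_t(α)` form a matrix that is diagonally
dominant by columns; this makes them even linearly independent, unless `n = 0`. -/
theorem StronglyNeighborly.affineIndependent {n : ℕ} {A : Set (Fin n → ℤ)} {t : ℝ}
    (ht : ((n + 1).factorial : ℝ) < t)
    {σ : Finset (Fin n → ℤ)} (hσ : StronglyNeighborly A (σ : Set (Fin n → ℤ))) :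
    AffineIndependent ℝ fun α : σ => expPoint t α.1 := by
  classical
  rcases Nat.eq_zero_or_pos n with rfl | hn
  · exact affineIndependent_of_subsingleton ℝ _
  have : NeZero n := ⟨hn.ne'⟩
  have ht1 : 1 < t :=
    lt_of_le_of_lt (by exact_mod_cast (Nat.factorial_pos (n + 1))) ht
  have ht0 : 0 < t := zero_lt_one.trans ht1
  have htn : (n : ℝ) < t := by
    have h : (2 * n : ℝ) ≤ (n + 1).factorial := by exact_mod_cast two_mul_le_factorial_succ n
    have : (0 : ℝ) ≤ n := by positivity
    linarith
  obtain ⟨J, hJ, hJinj⟩ := hσ.exists_dominant_coords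
  have hdet : (Matrix.of fun α β : σ => t ^ (α.1 (J β.1))).det ≠ 0 := by
    refine det_ne_zero_of_sum_col_lt_diag fun β => ?_
    simp only [Matrix.of_apply, Real.norm_eq_abs, abs_of_pos (zpow_pos ht0 _)]
    have hpos := zpow_pos ht0 (β.1 (J β.1))
    calc ∑ α ∈ Finset.univ.erase β, t ^ (α.1 (J β.1))
        ≤ ∑ α ∈ Finset.univ.erase β, t ^ (β.1 (J β.1)) / t := by
          refine Finset.sum_le_sum fun α hα => ?_
          have h := hJ β.1 β.2 α.1 α.2 fun h => Finset.ne_of_mem_erase hα (Subtype.ext h)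
          rw [div_eq_mul_inv, ← zpow_sub_one₀ ht0.ne']
          exact zpow_le_zpow_right₀ ht1.le (by omega)
      _ ≤ n * (t ^ (β.1 (J β.1)) / t) := by
          rw [Finset.sum_const, nsmul_eq_mul]
          refine mul_le_mul_of_nonneg_right ?_ (by positivity)
          have h1 : (Finset.univ.erase β).card ≤ Fintype.card σ := Finset.card_le_univ _
          exact_mod_cast h1.trans (by simpa using Fintype.card_le_of_injective _ hJinj)
      _ < t ^ (β.1 (J β.1)) := by
          rw [mul_div_assoc', div_lt_iff₀ ht0, mul_comm]
          exact mul_lt_mul_of_pos_left htn hpos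
  have hlin : LinearIndependent ℝ fun α : σ => expPoint t α.1 :=
    LinearIndependent.of_comp (LinearMap.funLeft ℝ ℝ fun α : σ => J α.1)
      (Matrix.linearIndependent_rows_of_det_ne_zero hdet)
  exact hlin.affineIndependent

/-! ### Strongly neighborly sets as exposed faces -/

theorem expPoint_mem_hullPolyhedron {n : ℕ} {t : ℝ} {A : Set (Fin n → ℤ)} {α : Fin n → ℤ}
    (hα : α ∈ A) : expPoint t α ∈ hullPolyhedron t A :=
  ⟨0, Set.self_mem_Ici, expPoint t α, subset_convexHull ℝ _ ⟨α, hα, rfl⟩, zero_add _⟩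

theorem expPoint_mem_cellBody {n : ℕ} {t : ℝ} {F : Finset (Fin n → ℤ)} {α : Fin n → ℤ}
    (hα : α ∈ F) : expPoint t α ∈ cellBody t F :=
  subset_convexHull ℝ _ ⟨α, hα, rfl⟩

theorem dotProduct_eq_of_mem_cellBody {n : ℕ} {t v : ℝ} {σ : Finset (Fin n → ℤ)}
    {w : Fin n → ℝ} (hσ : ∀ α ∈ σ, w ⬝ᵥ expPoint t α = v) {x : Fin n → ℝ}
    (hx : x ∈ cellBody t σ) : w ⬝ᵥ x = v := by
  have hconv : Convex ℝ {x : Fin n → ℝ | w ⬝ᵥ x = v} :=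
    convex_hyperplane ((dotProductBilin ℝ ℝ w).isLinear) v
  refine convexHull_min ?_ hconv hx
  rintro _ ⟨α, hα, rfl⟩
  exact hσ α hα

/-- The set `{w > v} ∪ conv (E_t(σ))` is convex, contains `E_t(A)`, and absorbs the addition of
nonnegative vectors. -/
theorem hullPolyhedron_subset_of_weight {n : ℕ} {t v : ℝ} {A : Set (Fin n → ℤ)}
    {σ : Finset (Fin n → ℤ)} {w : Fin n → ℝ} (hw : ∀ j, 0 < w j)
    (hσ : ∀ α ∈ σ, w ⬝ᵥ expPoint t α = v) (hA : ∀ α ∈ A, α ∉ σ → v < w ⬝ᵥ expPoint t α) :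
    hullPolyhedron t A ⊆ {x | v < w ⬝ᵥ x} ∪ cellBody t σ := by
  have hge : ∀ x ∈ {x | v < w ⬝ᵥ x} ∪ cellBody t σ, v ≤ w ⬝ᵥ x := by
    rintro x (hx | hx)
    exacts [le_of_lt hx, (dotProduct_eq_of_mem_cellBody hσ hx).ge]
  have hconv : Convex ℝ ({x | v < w ⬝ᵥ x} ∪ cellBody t σ) := by
    refine convex_iff_forall_pos.2 fun x hx y hy a b ha hb hab => ?_
    have key : v < w ⬝ᵥ x ∨ v < w ⬝ᵥ y → v < w ⬝ᵥ (a • x + b • y) := by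
      intro h
      have h1 := hge x hx
      have h2 := hge y hy
      rw [dotProduct_add, dotProduct_smul, dotProduct_smul, smul_eq_mul, smul_eq_mul]
      have hv : v = a * v + b * v := by rw [← add_mul, hab, one_mul]
      rcases h with h | h
      · nlinarith [mul_lt_mul_of_pos_left h ha, mul_le_mul_of_nonneg_left h2 hb.le]
      · nlinarith [mul_lt_mul_of_pos_left h hb, mul_le_mul_of_nonneg_left h1 ha.le]
    rcases hx with hx' | hx'
    · exact Or.inl (key (Or.inl hx'))
    rcases hy with hy' | hy'
    · exact Or.inl (key (Or.inr hy'))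
    exact Or.inr (convex_convexHull ℝ _ hx' hy' ha.le hb.le hab)
  rintro _ ⟨u, hu, x, hx, rfl⟩
  have hxmem : x ∈ {x | v < w ⬝ᵥ x} ∪ cellBody t σ := by
    refine convexHull_min ?_ hconv hx
    rintro _ ⟨α, hα, rfl⟩
    by_cases hασ : α ∈ σ
    · exact Or.inr (expPoint_mem_cellBody hασ)
    · exact Or.inl (hA α hα hασ)
  by_cases hu0 : u = 0
  · simpa [hu0] using hxmem
  left
  have hpos : 0 < w ⬝ᵥ u := by
    obtain ⟨j, hj⟩ := Function.ne_iff.1 hu0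
    exact Finset.sum_pos' (fun l _ => mul_nonneg (hw l).le (hu l))
      ⟨j, Finset.mem_univ j, mul_pos (hw j) (lt_of_le_of_ne (hu j) (Ne.symm hj))⟩
  have := hge x hxmem
  show v < w ⬝ᵥ (u + x)
  rw [dotProduct_add]
  linarith

theorem cellBody_subset_hullPolyhedron {n : ℕ} {t : ℝ} {A : Set (Fin n → ℤ)}
    {F : Finset (Fin n → ℤ)} (hF : (F : Set (Fin n → ℤ)) ⊆ A) :
    cellBody t F ⊆ hullPolyhedron t A := fun x hx =>
  ⟨0, Set.self_mem_Ici, x, convexHull_mono (Set.image_mono hF) hx, zero_add x⟩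

theorem StronglyNeighborly.isExposed_cellBody {n : ℕ} {A : Set (Fin n → ℤ)} {t : ℝ}
    (ht : ((n + 1).factorial : ℝ) < t)
    {σ : Finset (Fin n → ℤ)} (hσ : StronglyNeighborly A (σ : Set (Fin n → ℤ))) :
    IsExposed ℝ (hullPolyhedron t A) (cellBody t σ) := by
  obtain ⟨w, v, hw, hwσ, hwA⟩ := hσ.exists_weight ht
  have hsub := hullPolyhedron_subset_of_weight hw hwσ hwA
  rintro -
  refine ⟨-LinearMap.toContinuousLinearMap (dotProductBilin ℝ ℝ w), ?_⟩
  obtain ⟨α, hα⟩ := hσ.2.1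
  ext x
  constructor
  · refine fun hx => ⟨cellBody_subset_hullPolyhedron hσ.1 hx, fun y hy => ?_⟩
    have hxv := dotProduct_eq_of_mem_cellBody hwσ hx
    have hyv : v ≤ w ⬝ᵥ y := by
      rcases hsub hy with h | h
      exacts [le_of_lt h, (dotProduct_eq_of_mem_cellBody hwσ h).ge]
    simpa [hxv] using hyv
  · rintro ⟨hx, hmax⟩
    have h := hmax _ (expPoint_mem_hullPolyhedron (hσ.1 hα))
    have h' : w ⬝ᵥ x ≤ v := by simpa [hwσ α hα] using h
    rcases hsub hx with hlt | hmem
    exacts [absurd h' (not_le.2 hlt), hmem]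

theorem StronglyNeighborly.mem_hullCells {n : ℕ} {A : Set (Fin n → ℤ)} {t : ℝ}
    (ht : ((n + 1).factorial : ℝ) < t)
    {σ : Finset (Fin n → ℤ)} (hσ : StronglyNeighborly A (σ : Set (Fin n → ℤ))) :
    σ ∈ hullCells t A :=
  ⟨by exact_mod_cast hσ.2.1, hσ.1, (hσ.isExposed_cellBody ht).isExtreme⟩

/-- The supporting functional of `σ` attains its minimum over `E_t(A)` only on `E_t(σ)`; hence
`τ ⊆ σ`. -/
theorem StronglyNeighborly.of_cellBody_subset {n : ℕ} {A : Set (Fin n → ℤ)} {t : ℝ}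
    (ht : ((n + 1).factorial : ℝ) < t)
    {σ τ : Finset (Fin n → ℤ)} (hσ : StronglyNeighborly A (σ : Set (Fin n → ℤ)))
    (hτ : τ ∈ hullCells t A) (h : cellBody t τ ⊆ cellBody t σ) :
    StronglyNeighborly A (τ : Set (Fin n → ℤ)) := by
  obtain ⟨w, v, hw, hwσ, hwA⟩ := hσ.exists_weight ht
  refine hσ.subset (fun α hα => ?_) hτ.1
  by_contra hασ
  exact (hwA α (hτ.2.1 hα) hασ).ne'
    (dotProduct_eq_of_mem_cellBody hwσ (h (expPoint_mem_cellBody hα)))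

/-! ### Orientations through alternating forms -/

/-- The alternating form `x ↦ det (b_i ⬝ x_j)` attached to vectors `b_1, …, b_d` of `ℝⁿ`. On the
span of linearly independent `b_i`, it is positive exactly on the frames oriented like `b`. -/
noncomputable def frameForm {n d : ℕ} (b : Fin d → Fin n → ℝ) :
    (Fin n → ℝ) [⋀^Fin d]→ₗ[ℝ] ℝ :=
  Matrix.detRowAlternating.compLinearMap (LinearMap.pi fun i => dotProductBilin ℝ ℝ (b i))

theorem frameForm_apply {n d : ℕ} (b x : Fin d → Fin n → ℝ) :
    frameForm b x = (Matrix.of fun j i => b i ⬝ᵥ x j).det := rfl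

theorem frameForm_apply_transpose {n d : ℕ} (b x : Fin d → Fin n → ℝ) :
    frameForm b x = (Matrix.of fun i j => b i ⬝ᵥ x j).det := by
  rw [frameForm_apply, ← Matrix.det_transpose]
  rfl

/-- This is the Gram determinant of `b`. -/
theorem frameForm_self_pos {n d : ℕ} {b : Fin d → Fin n → ℝ} (hb : LinearIndependent ℝ b) :
    0 < frameForm b b := by
  have h := Matrix.PosDef.mul_conjTranspose_self (Matrix.of b)
    (Matrix.vecMul_injective_iff.2 hb)
  rw [frameForm_apply_transpose]
  exact h.det_pos

/-- The vectors from the first vertex of a simplex to the other ones. -/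
def edgeFrame {n d : ℕ} (p : Fin (d + 1) → Fin n → ℝ) : Fin d → Fin n → ℝ :=
  fun l => p l.succ - p 0

theorem linearIndependent_edgeFrame {n d : ℕ} {p : Fin (d + 1) → Fin n → ℝ}
    (hp : AffineIndependent ℝ p) : LinearIndependent ℝ (edgeFrame p) := by
  have h := (affineIndependent_iff_linearIndependent_vsub ℝ p 0).1 hp
  exact h.comp (fun l : Fin d => ⟨l.succ, l.succ_ne_zero⟩)
    fun a b hab => Fin.succ_injective _ (congrArg Subtype.val hab)

/-- In homogeneous coordinates all vertices of the simplex play the same role, which makes the effect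
of a permutation of the vertices visible. -/
theorem det_homogeneous_eq_frameForm {n d : ℕ} (b : Fin d → Fin n → ℝ)
    (p : Fin (d + 1) → Fin n → ℝ) :
    (Matrix.of fun l : Fin (d + 1) =>
      (Fin.cons 1 (fun i => b i ⬝ᵥ p l) : Fin (d + 1) → ℝ)).det = frameForm b (edgeFrame p) := by
  -- subtract the first row from all others, then expand along the first column
  let B : Matrix (Fin (d + 1)) (Fin (d + 1)) ℝ := Matrix.of
    (Fin.cons (Fin.cons 1 (fun i => b i ⬝ᵥ p 0))
      fun l => Fin.cons 0 (fun i => b i ⬝ᵥ (p l.succ - p 0)))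
  rw [Matrix.det_eq_of_forall_row_eq_smul_add_const (B := B) (Fin.cons 0 fun _ => 1) 0 rfl]
  · rw [Matrix.det_succ_column_zero, Fin.sum_univ_succ, Finset.sum_eq_zero]
    · simp [B, frameForm_apply, edgeFrame, dotProduct_sub]
      rfl
    · intro i _
      simp [B]
  · intro l i
    refine Fin.cases ?_ (fun l => ?_) l <;> refine Fin.cases ?_ (fun i => ?_) i <;>
      simp [B, dotProduct_sub]

theorem frameForm_edgeFrame_comp_perm {n d : ℕ} (b : Fin d → Fin n → ℝ)
    (p : Fin (d + 1) → Fin n → ℝ) (e : Equiv.Perm (Fin (d + 1))) :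
    frameForm b (edgeFrame (p ∘ e)) = (Equiv.Perm.sign e : ℤ) * frameForm b (edgeFrame p) := by
  rw [← det_homogeneous_eq_frameForm, ← det_homogeneous_eq_frameForm, ← Matrix.det_permute]
  rfl

/-- Moving the `j`-th vertex to the front is a cyclic permutation of sign `(-1) ^ j`. -/
theorem frameForm_sub_apply {n d : ℕ} (b : Fin (d + 1) → Fin n → ℝ)
    (p : Fin (d + 2) → Fin n → ℝ) (j : Fin (d + 2)) :
    frameForm b (fun l => p (j.succAbove l) - p j) =
      (-1) ^ (j : ℕ) * frameForm b (edgeFrame p) := by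
  have h := frameForm_edgeFrame_comp_perm b p j.cycleRange.symm
  have h1 : edgeFrame (p ∘ j.cycleRange.symm) = fun l => p (j.succAbove l) - p j := by
    funext l
    simp [edgeFrame, Fin.cycleRange_symm_succ, Fin.cycleRange_symm_zero]
  rw [h1, Equiv.Perm.sign_symm, Fin.sign_cycleRange] at h
  rw [h]
  push_cast
  rfl

theorem frameForm_cons_sub_edgeFrame {n d : ℕ} (b : Fin (d + 1) → Fin n → ℝ)
    (q : Fin (d + 1) → Fin n → ℝ) (a : Fin n → ℝ) :
    frameForm b (Fin.cons (q 0 - a) (edgeFrame q) : Fin (d + 1) → Fin n → ℝ) =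
      frameForm b (fun l => q l - a) := by
  symm
  rw [frameForm_apply, frameForm_apply]
  refine Matrix.det_eq_of_forall_row_eq_smul_add_const (Fin.cons 0 fun _ => 1) 0 rfl ?_
  intro l i
  refine Fin.cases ?_ (fun l => ?_) l <;> simp [edgeFrame, dotProduct_sub]

theorem frameForm_cons_add_sum {n d : ℕ} (b : Fin (d + 1) → Fin n → ℝ)
    (x : Fin d → Fin n → ℝ) (c c' : ℝ) (a : Fin n → ℝ) :
    frameForm b (Fin.cons (c • a + c' • ∑ l, x l) x : Fin (d + 1) → Fin n → ℝ) =
      c * frameForm b (Fin.cons a x : Fin (d + 1) → Fin n → ℝ) := by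
  have h0 : ∀ l, (frameForm b).curryLeft (x l) x = 0 := fun l => by
    rw [AlternatingMap.curryLeft_apply_apply]
    exact (frameForm b).map_eq_zero_of_eq _ (i := 0) (j := l.succ) (by simp)
      (Fin.succ_ne_zero l).symm
  let g : (Fin n → ℝ) →ₗ[ℝ] ℝ :=
    { toFun := fun y => (frameForm b).curryLeft y x
      map_add' := fun y z => by rw [map_add, AlternatingMap.add_apply]
      map_smul' := fun r y => by rw [map_smul, AlternatingMap.smul_apply, RingHom.id_apply] }
  have h : g (c • a + c' • ∑ l, x l) = c * g a := by
    have h1 : ∑ l, g (x l) = 0 := Finset.sum_eq_zero fun l _ => h0 l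
    rw [map_add, map_smul, map_smul, map_sum, h1, smul_zero, add_zero, smul_eq_mul]
  exact h

/-- Both sides compare alternating forms of top degree on the `d`-dimensional space `V`. -/
theorem alternatingMap_mul_frameForm_self {n d : ℕ} {V : Submodule ℝ (Fin n → ℝ)}
    (b : Module.Basis (Fin d) ℝ V) (η : (Fin n → ℝ) [⋀^Fin d]→ₗ[ℝ] ℝ)
    {x : Fin d → Fin n → ℝ} (hx : ∀ l, x l ∈ V) :
    η x * frameForm (fun i => (b i : Fin n → ℝ)) (fun i => (b i : Fin n → ℝ)) =
      η (fun i => (b i : Fin n → ℝ)) * frameForm (fun i => (b i : Fin n → ℝ)) x := by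
  have key : ∀ ω : (Fin n → ℝ) [⋀^Fin d]→ₗ[ℝ] ℝ,
      ω x = ω (fun i => (b i : Fin n → ℝ)) * b.det (fun l => ⟨x l, hx l⟩) := fun ω =>
    congrArg (fun f => f fun l => (⟨x l, hx l⟩ : V))
      ((ω.compLinearMap V.subtype).eq_smul_basis_det b)
  rw [key η, key (frameForm _)]
  ring

theorem linearIndependent_coe_basis {n d : ℕ} {V : Submodule ℝ (Fin n → ℝ)}
    (b : Module.Basis (Fin d) ℝ V) : LinearIndependent ℝ fun i => (b i : Fin n → ℝ) :=
  b.linearIndependent.map' V.subtype V.ker_subtype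

theorem frameForm_ne_zero {n d : ℕ} {V : Submodule ℝ (Fin n → ℝ)}
    (b : Module.Basis (Fin d) ℝ V) {x : Fin d → Fin n → ℝ} (hx : ∀ l, x l ∈ V)
    (hlin : LinearIndependent ℝ x) : frameForm (fun i => (b i : Fin n → ℝ)) x ≠ 0 := by
  have h := alternatingMap_mul_frameForm_self b (frameForm x) hx
  intro h0
  rw [h0, mul_zero] at h
  exact (mul_pos (frameForm_self_pos hlin)
    (frameForm_self_pos (linearIndependent_coe_basis b))).ne' h

/-! ### Vertices in lexicographic order -/

/-- The vertices of `σ` in lexicographic order. -/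
noncomputable def vertexList {n m : ℕ} (σ : Finset (Fin n → ℤ)) (h : σ.card = m) :
    Fin m → Fin n → ℤ :=
  fun l => ofLex ((σ.map toLex.toEmbedding).orderEmbOfFin (by rwa [Finset.card_map]) l)

section vertexList

variable {n m : ℕ} {σ : Finset (Fin n → ℤ)} (h : σ.card = m)

theorem vertexList_mem (l : Fin m) : vertexList σ h l ∈ σ := by
  have hm := (σ.map toLex.toEmbedding).orderEmbOfFin_mem (by rwa [Finset.card_map]) l
  obtain ⟨α, hα, hαl⟩ := Finset.mem_map.1 hm
  unfold vertexList
  rw [← hαl]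
  exact hα

theorem vertexList_strictMono : StrictMono fun l => toLex (vertexList σ h l) :=
  ((σ.map toLex.toEmbedding).orderEmbOfFin (by rwa [Finset.card_map])).strictMono

theorem vertexList_injective : Function.Injective (vertexList σ h) := fun _ _ hab =>
  (vertexList_strictMono h).injective (congrArg toLex hab)

theorem image_vertexList [DecidableEq (Fin n → ℤ)] :
    Finset.univ.image (vertexList σ h) = σ := by
  refine Finset.eq_of_subset_of_card_le ?_ ?_
  · intro α hα
    obtain ⟨l, -, rfl⟩ := Finset.mem_image.1 hα
    exact vertexList_mem h l
  · rw [Finset.card_image_of_injective _ (vertexList_injective h), Finset.card_univ,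
      Fintype.card_fin, h]

theorem range_vertexList : Set.range (vertexList σ h) = σ := by
  classical
  conv_rhs => rw [← image_vertexList h]
  simp

theorem vertexList_unique {f : Fin m → Fin n → ℤ} (hf : ∀ l, f l ∈ σ)
    (hmono : StrictMono fun l => toLex (f l)) : f = vertexList σ h := by
  have := Finset.orderEmbOfFin_unique (s := σ.map toLex.toEmbedding) (by rwa [Finset.card_map])
    (f := fun l => toLex (f l)) (fun l => Finset.mem_map_of_mem _ (hf l)) hmono
  funext l
  exact congrArg ofLex (congrFun this l)

theorem position_vertexList (j : Fin m) : position σ (vertexList σ h j) = j := by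
  classical
  unfold position
  have himg : (σ.filter fun β => toLex β < toLex (vertexList σ h j)) =
      (Finset.Iio j).image (vertexList σ h) := by
    ext β
    rw [Finset.mem_filter, Finset.mem_image]
    constructor
    · rintro ⟨hβ, hlt⟩
      obtain ⟨l, rfl⟩ : β ∈ Set.range (vertexList σ h) := by
        rw [range_vertexList]; exact hβ
      exact ⟨l, Finset.mem_Iio.2 ((vertexList_strictMono h).lt_iff_lt.1 hlt), rfl⟩
    · rintro ⟨l, hl, rfl⟩
      exact ⟨vertexList_mem h l, vertexList_strictMono h (Finset.mem_Iio.1 hl)⟩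
  have hcard : ((Finset.Iio j).image (vertexList σ h)).card = j := by
    rw [Finset.card_image_of_injective _ (vertexList_injective h), Fin.card_Iio]
  rw [← hcard, ← himg]

end vertexList

theorem vertexList_erase {n d : ℕ} {σ : Finset (Fin n → ℤ)} (h : σ.card = d + 1)
    {j : Fin (d + 1)} {α : Fin n → ℤ} (hj : vertexList σ h j = α)
    {G : Finset (Fin n → ℤ)} (hG : σ.erase α = G) (h' : G.card = d) :
    vertexList G h' = vertexList σ h ∘ j.succAbove := by
  subst hG hj
  refine (vertexList_unique h' (fun l => ?_) ?_).symm
  · exact Finset.mem_erase.2 ⟨fun he => Fin.succAbove_ne j l (vertexList_injective h he),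
      vertexList_mem h _⟩
  · exact (vertexList_strictMono h).comp (Fin.strictMono_succAbove j)

theorem sum_vertexList {n m : ℕ} {σ : Finset (Fin n → ℤ)} (h : σ.card = m)
    {M : Type*} [AddCommMonoid M] (f : (Fin n → ℤ) → M) :
    ∑ α ∈ σ, f α = ∑ l, f (vertexList σ h l) := by
  classical
  conv_lhs => rw [← image_vertexList h]
  exact Finset.sum_image fun _ _ _ _ hab => vertexList_injective h hab

/-- The vertices of the simplex `conv (E_t(σ))` in lexicographic order. -/
noncomputable def simplexVertices {n m : ℕ} (t : ℝ) (σ : Finset (Fin n → ℤ)) (h : σ.card = m) :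
    Fin m → Fin n → ℝ :=
  fun l => expPoint t (vertexList σ h l)

theorem range_simplexVertices {n m : ℕ} (t : ℝ) {σ : Finset (Fin n → ℤ)} (h : σ.card = m) :
    Set.range (simplexVertices t σ h) = expPoint t '' (σ : Set (Fin n → ℤ)) := by
  rw [← range_vertexList h, ← Set.range_comp]
  rfl

theorem affineIndependent_simplexVertices {n m : ℕ} {t : ℝ} {σ : Finset (Fin n → ℤ)}
    (h : σ.card = m) (hσ : AffineIndependent ℝ fun α : σ => expPoint t α.1) :
    AffineIndependent ℝ (simplexVertices t σ h) := by
  let f : Fin m ↪ σ := ⟨fun l => ⟨vertexList σ h l, vertexList_mem h l⟩, fun _ _ hab =>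
    vertexList_injective h (congrArg (fun α : σ => α.1) hab)⟩
  have h1 : simplexVertices t σ h = (fun α : σ => expPoint t α.1) ∘ f := rfl
  rw [h1]
  exact hσ.comp_embedding f

theorem cellDim_eq {n d : ℕ} {t : ℝ} {σ : Finset (Fin n → ℤ)} (h : σ.card = d + 1)
    (hσ : AffineIndependent ℝ fun α : σ => expPoint t α.1) : cellDim t σ = d := by
  unfold cellDim cellSpan
  rw [← range_simplexVertices t h]
  exact (affineIndependent_simplexVertices h hσ).finrank_vectorSpan (by simp)

theorem edgeFrame_simplexVertices_mem {n d : ℕ} (t : ℝ) {σ : Finset (Fin n → ℤ)}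
    (h : σ.card = d + 1) (l : Fin d) :
    edgeFrame (simplexVertices t σ h) l ∈ cellSpan t σ := by
  unfold cellSpan
  rw [← range_simplexVertices t h]
  exact vsub_mem_vectorSpan ℝ (Set.mem_range_self _) (Set.mem_range_self _)

/-! ### Incidence numbers of simplices -/

/-- The sign comparing the chosen orientation of the simplex `conv (E_t(σ))` with the one given by
the lexicographic order of its vertices. -/
noncomputable def simplexSign {n d : ℕ} {t : ℝ} (o : CellOrientation n t)
    (σ : Finset (Fin n → ℤ)) (h : σ.card = d + 1) (hdim : cellDim t σ = d) : SignType :=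
  SignType.sign (frameForm (fun i => (o σ (Fin.cast hdim.symm i) : Fin n → ℝ))
    (edgeFrame (simplexVertices t σ h)))

theorem simplexSign_ne_zero {n d : ℕ} {t : ℝ} (o : CellOrientation n t)
    {σ : Finset (Fin n → ℤ)} (h : σ.card = d + 1) (hdim : cellDim t σ = d)
    (hσ : AffineIndependent ℝ fun α : σ => expPoint t α.1) : simplexSign o σ h hdim ≠ 0 := by
  refine sign_ne_zero.2 ?_
  have hne := frameForm_ne_zero ((o σ).reindex (finCongr hdim))
    (edgeFrame_simplexVertices_mem t h)
    (linearIndependent_edgeFrame (affineIndependent_simplexVertices h hσ))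
  simpa only [Module.Basis.reindex_apply, finCongr_symm, finCongr_apply] using hne

/-- Modulo the direction space of the facet, the vector between the barycenters is a positive
multiple of a vector pointing away from the opposite vertex. -/
theorem barycenter_erase_sub {n d : ℕ} (t : ℝ) {σ : Finset (Fin n → ℤ)} (h : σ.card = d + 2)
    {j : Fin (d + 2)} {α : Fin n → ℤ} (hj : vertexList σ h j = α)
    {G : Finset (Fin n → ℤ)} (hG : σ.erase α = G) (h' : G.card = d + 1) :
    barycenter t G - barycenter t σ =
      (d + 2 : ℝ)⁻¹ • (simplexVertices t G h' 0 - simplexVertices t σ h j) +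
        ((d + 2 : ℝ)⁻¹ * (d + 1 : ℝ)⁻¹) •
          ∑ l, edgeFrame (simplexVertices t G h') l := by
  subst hG hj
  set q := simplexVertices t (σ.erase (vertexList σ h j)) h' with hq
  have h1 : ∑ α ∈ σ.erase (vertexList σ h j), expPoint t α = ∑ l, q l := sum_vertexList h' _
  have h2 : ∑ α ∈ σ, expPoint t α = simplexVertices t σ h j + ∑ l, q l := by
    rw [← h1]
    exact (Finset.add_sum_erase _ _ (vertexList_mem h j)).symm
  have h3 : ∑ l, edgeFrame q l = ∑ l, q l - (d + 1 : ℝ) • q 0 := by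
    rw [Fin.sum_univ_succ]
    simp only [edgeFrame, Finset.sum_sub_distrib, Finset.sum_const, Finset.card_univ,
      Fintype.card_fin, add_smul, one_smul, Nat.cast_smul_eq_nsmul]
    abel
  unfold barycenter
  rw [h1, h2, h3, h, h']
  ext i
  simp only [Pi.sub_apply, Pi.add_apply, Pi.smul_apply, smul_eq_mul]
  have hd1 : (d + 1 : ℝ) ≠ 0 := by positivity
  have hd2 : (d + 2 : ℝ) ≠ 0 := by positivity
  push_cast
  field_simp
  ring

/-- Relative to the lexicographic orientations, the incidence number of `σ` and `σ ∖ {α}` is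
`(-1) ^ position σ α`. -/
theorem incidence_mul_simplexSign {n d : ℕ} {t : ℝ} (o : CellOrientation n t)
    {σ : Finset (Fin n → ℤ)} {α : Fin n → ℤ} (hα : α ∈ σ)
    {G : Finset (Fin n → ℤ)} (hG : σ.erase α = G) (h : σ.card = d + 2) (hdim : cellDim t σ = d + 1)
    (h' : G.card = d + 1) (hdim' : cellDim t G = d) (hh : cellDim t σ = cellDim t G + 1) :
    incidence o σ G hh * simplexSign o G h' hdim' =
      (-1) ^ position σ α * simplexSign o σ h hdim := by
  subst hdim'
  obtain ⟨j, hj⟩ : α ∈ Set.range (vertexList σ h) := by rw [range_vertexList]; exact hα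
  have hj' : position σ α = j := by rw [← hj, position_vertexList]
  set p := simplexVertices t σ h with hp
  set q := simplexVertices t G h' with hq
  set ω := frameForm fun i => (o σ (Fin.cast hdim.symm i) : Fin n → ℝ) with hω
  set v := barycenter t G - barycenter t σ with hv
  have hqp : ∀ l, q l = p (j.succAbove l) := fun l =>
    congrArg (expPoint t) (congrFun (vertexList_erase h hj hG h') l)
  have hc : (0 : ℝ) < (cellDim t G + 2 : ℝ)⁻¹ := by positivity
  have hη : ω (Fin.cons v (edgeFrame q) : Fin (cellDim t G + 1) → Fin n → ℝ) =
      (cellDim t G + 2 : ℝ)⁻¹ * ((-1) ^ (j : ℕ) * ω (edgeFrame p)) := by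
    rw [hv, barycenter_erase_sub t h hj hG h', frameForm_cons_add_sum, frameForm_cons_sub_edgeFrame,
      ← frameForm_sub_apply]
    simp only [← hqp]
    rfl
  have hinc : incidence o σ G hh = SignType.sign (ω (Fin.cons v fun l => (o G l : Fin n → ℝ))) := by
    rw [hω, frameForm_apply_transpose]
    rfl
  have hpos := frameForm_self_pos (linearIndependent_coe_basis (o G))
  have hcomp := alternatingMap_mul_frameForm_self (o G) (ω.curryLeft v)
    (edgeFrame_simplexVertices_mem t h')
  rw [hinc, hj']
  calc SignType.sign (ω (Fin.cons v fun l => (o G l : Fin n → ℝ))) * simplexSign o G h' rfl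
      = SignType.sign (ω.curryLeft v (fun i => (o G i : Fin n → ℝ)) *
          frameForm (fun i => (o G i : Fin n → ℝ)) (edgeFrame q)) := by
        rw [sign_mul]
        rfl
    _ = SignType.sign (ω.curryLeft v (edgeFrame q)) := by
        rw [← hcomp, sign_mul, sign_pos hpos, mul_one]
    _ = SignType.sign (ω (Fin.cons v (edgeFrame q) : Fin (cellDim t G + 1) → Fin n → ℝ)) := rfl
    _ = (-1) ^ (j : ℕ) * simplexSign o σ h hdim := by
        rw [hη, sign_mul, sign_pos hc, one_mul, sign_mul, sign_pow, Left.sign_neg, sign_one]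
        rfl

/-! ### The embedding of complexes -/

/-- A face of the Scarf complex, as a cell of the hull complex. -/
def SimplexOfDim.toHullCell {n : ℕ} {A : Set (Fin n → ℤ)} {t : ℝ}
    (ht : ((n + 1).factorial : ℝ) < t) {i : ℕ} (σ : SimplexOfDim (scarfComplex A) i) :
    HullCellOfDim t A i :=
  ⟨σ.1, StronglyNeighborly.mem_hullCells ht σ.2.1,
    cellDim_eq σ.2.2 (StronglyNeighborly.affineIndependent ht σ.2.1)⟩

theorem SimplexOfDim.cellDim_eq_cellDim_erase_add_one {n : ℕ} {A : Set (Fin n → ℤ)} {t : ℝ}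
    (ht : ((n + 1).factorial : ℝ) < t) {i : ℕ} (σ : SimplexOfDim (scarfComplex A) (i + 1))
    (α : {α // α ∈ σ.1}) : cellDim t σ.1 = cellDim t (σ.1.erase α.1) + 1 :=
  (σ.toHullCell ht).2.2.trans (congrArg (· + 1) ((σ.erase α).toHullCell ht).2.2).symm

theorem exists_units_eq_simplexSign {n : ℕ} {A : Set (Fin n → ℤ)} {t : ℝ}
    (ht : ((n + 1).factorial : ℝ) < t) (o : CellOrientation n t) {i : ℕ}
    (σ : SimplexOfDim (scarfComplex A) i) :
    ∃ u : ℤˣ, (u : ℤ) = (simplexSign o σ.1 σ.2.2 (σ.toHullCell ht).2.2 : SignType) := by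
  have h := simplexSign_ne_zero o σ.2.2 (σ.toHullCell ht).2.2
    (StronglyNeighborly.affineIndependent ht σ.2.1)
  generalize simplexSign o σ.1 σ.2.2 (σ.toHullCell ht).2.2 = s at h
  cases s
  · exact absurd rfl h
  · exact ⟨-1, rfl⟩
  · exact ⟨1, rfl⟩

/-- The sign `±1` with which `e_σ` is sent to the generator of the cell `σ`: it compares the chosen
orientation with the one given by the lexicographic order of the vertices. -/
noncomputable def orientationUnit {n : ℕ} {A : Set (Fin n → ℤ)} {t : ℝ}
    (ht : ((n + 1).factorial : ℝ) < t) (o : CellOrientation n t) {i : ℕ}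
    (σ : SimplexOfDim (scarfComplex A) i) : ℤˣ :=
  (exists_units_eq_simplexSign ht o σ).choose

theorem orientationUnit_eq_simplexSign {n : ℕ} {A : Set (Fin n → ℤ)} {t : ℝ}
    (ht : ((n + 1).factorial : ℝ) < t) (o : CellOrientation n t) {i : ℕ}
    (σ : SimplexOfDim (scarfComplex A) i) : (orientationUnit ht o σ : ℤ) =
      (simplexSign o σ.1 σ.2.2 (σ.toHullCell ht).2.2 : SignType) :=
  (exists_units_eq_simplexSign ht o σ).choose_spec

/-- The coefficients of `e_{σ ∖ α}` in the images of `d e_σ` and in the differential of the image of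
`e_σ` agree. -/
theorem orientationUnit_mul_incidence {n : ℕ} {A : Set (Fin n → ℤ)} {t : ℝ}
    (ht : ((n + 1).factorial : ℝ) < t) (o : CellOrientation n t) {i : ℕ}
    (σ : SimplexOfDim (scarfComplex A) (i + 1)) (α : {α // α ∈ σ.1})
    (h : cellDim t σ.1 = cellDim t (σ.1.erase α.1) + 1) :
    (orientationUnit ht o σ : ℤ) * (incidence o σ.1 (σ.1.erase α.1) h : SignType) =
      (-1) ^ position σ.1 α.1 * orientationUnit ht o (σ.erase α) := by
  have key : ((incidence o σ.1 (σ.1.erase α.1) h : SignType) : ℤ) *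
      orientationUnit ht o (σ.erase α) = (-1) ^ position σ.1 α.1 * orientationUnit ht o σ := by
    rw [orientationUnit_eq_simplexSign, orientationUnit_eq_simplexSign]
    have hs := congrArg (SignType.castHom (α := ℤ)) (incidence_mul_simplexSign o α.2 rfl σ.2.2
      (σ.toHullCell ht).2.2 (σ.erase α).2.2 ((σ.erase α).toHullCell ht).2.2 h)
    rw [map_mul, map_mul, map_pow] at hs
    exact hs
  have hG : (orientationUnit ht o (σ.erase α) : ℤ) * orientationUnit ht o (σ.erase α) = 1 := by
    rw [← Units.val_mul, Int.units_mul_self, Units.val_one]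
  have hσ : (orientationUnit ht o σ : ℤ) * orientationUnit ht o σ = 1 := by
    rw [← Units.val_mul, Int.units_mul_self, Units.val_one]
  -- multiply `key` by both signs, whose squares are `1`
  linear_combination (orientationUnit ht o σ : ℤ) * orientationUnit ht o (σ.erase α) * key -
    (orientationUnit ht o σ : ℤ) * (incidence o σ.1 (σ.1.erase α.1) h : SignType) * hG +
    (-1) ^ position σ.1 α.1 * (orientationUnit ht o (σ.erase α) : ℤ) * hσ

/-- The embedding of the algebraic Scarf complex into the cellular free complex of the hull
complex, in degree `i`. -/
noncomputable def scarfToHull {n : ℕ} (k : Type*) [Field k] {A : Set (Fin n → ℤ)} {t : ℝ}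
    (ht : ((n + 1).factorial : ℝ) < t) (o : CellOrientation n t) (i : ℕ) :
    TaylorModule k (scarfComplex A) i →ₗ[MvPolynomial (Fin n) k] HullModule k t A i :=
  Finsupp.linearCombination (MvPolynomial (Fin n) k) fun σ =>
    Finsupp.single (σ.toHullCell ht) (((orientationUnit ht o σ : ℤˣ) : ℤ) : MvPolynomial (Fin n) k)

theorem scarfToHull_single {n : ℕ} (k : Type*) [Field k] {A : Set (Fin n → ℤ)} {t : ℝ}
    (ht : ((n + 1).factorial : ℝ) < t) (o : CellOrientation n t) {i : ℕ}
    (σ : SimplexOfDim (scarfComplex A) i) (r : MvPolynomial (Fin n) k) :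
    scarfToHull k ht o i (Finsupp.single σ r) =
      Finsupp.single (σ.toHullCell ht) (r * ((orientationUnit ht o σ : ℤˣ) : ℤ)) := by
  rw [scarfToHull, Finsupp.linearCombination_single, Finsupp.smul_single, smul_eq_mul]

theorem scarfToHull_injective {n : ℕ} (k : Type*) [Field k] {A : Set (Fin n → ℤ)} {t : ℝ}
    (ht : ((n + 1).factorial : ℝ) < t) (o : CellOrientation n t) (i : ℕ) :
    Function.Injective (scarfToHull k (A := A) ht o i) := by
  have hinj : Function.Injective
      fun σ : SimplexOfDim (scarfComplex A) i => σ.toHullCell ht := fun σ τ h =>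
    Subtype.ext (congrArg (fun F : HullCellOfDim t A i => F.1) h)
  have hlin : LinearIndependent (MvPolynomial (Fin n) k)
      fun σ : SimplexOfDim (scarfComplex A) i =>
        Finsupp.single (σ.toHullCell ht) (1 : MvPolynomial (Fin n) k) :=
    (Finsupp.linearIndependent_single_one _ _).comp _ hinj
  have h := hlin.units_smul fun σ =>
    Units.map (Int.castRingHom (MvPolynomial (Fin n) k)).toMonoidHom (orientationUnit ht o σ)
  have heq : ((fun σ : SimplexOfDim (scarfComplex A) i =>
      Units.map (Int.castRingHom (MvPolynomial (Fin n) k)).toMonoidHom (orientationUnit ht o σ)) • fun σ : SimplexOfDim (scarfComplex A) i =>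
        Finsupp.single (σ.toHullCell ht) (1 : MvPolynomial (Fin n) k)) =
      fun σ : SimplexOfDim (scarfComplex A) i => Finsupp.single (σ.toHullCell ht)
        (((orientationUnit ht o σ : ℤˣ) : ℤ) : MvPolynomial (Fin n) k) := by
    funext σ
    rw [Pi.smul_apply', Units.smul_def, Finsupp.smul_single, smul_eq_mul, mul_one]
    rfl
  rw [heq] at h
  exact h

/-- The facets of a face `σ` of the Scarf complex are the sets `σ ∖ {α}`: a cell contained in `σ`
is again a face of the Scarf complex, so that its dimension determines its cardinality. -/
theorem hullD_single_toHullCell {n : ℕ} (k : Type*) [Field k] {A : Set (Fin n → ℤ)} {t : ℝ}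
    (ht : ((n + 1).factorial : ℝ) < t) (o : CellOrientation n t) {i : ℕ}
    (σ : SimplexOfDim (scarfComplex A) (i + 1)) (r : MvPolynomial (Fin n) k) :
    hullD k A o i (Finsupp.single (σ.toHullCell ht) r) =
      ∑ α ∈ σ.1.attach, Finsupp.single ((σ.erase α).toHullCell ht)
        (r * MvPolynomial.monomial (labelDiff σ.1 (σ.1.erase α.1))
          (((incidence o σ.1 (σ.1.erase α.1)
            (σ.cellDim_eq_cellDim_erase_add_one ht α) : SignType) : ℤ) : k)) := by
  classical
  rw [hullD, Finsupp.linearCombination_single, Finset.smul_sum]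
  symm
  refine Finset.sum_of_injOn (fun α => σ.1.erase α.1) ?_ ?_ ?_ ?_
  · rintro ⟨α, hα⟩ - ⟨β, hβ⟩ - h
    by_contra hne
    have hmem : α ∈ σ.1.erase β :=
      Finset.mem_erase.2 ⟨fun hab => hne (Subtype.ext hab), hα⟩
    simp only at h
    rw [← h] at hmem
    exact (Finset.mem_erase.1 hmem).1 rfl
  · intro α _
    exact Finset.mem_powerset.2 (Finset.erase_subset _ _)
  · intro G hG hGimg
    rw [dif_neg, smul_zero]
    rintro ⟨hcell, hdim⟩
    have hGσ : G ⊆ σ.1 := Finset.mem_powerset.1 hG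
    have hGscarf : StronglyNeighborly A (G : Set (Fin n → ℤ)) :=
      StronglyNeighborly.subset σ.2.1 hGσ hcell.1
    have hpos := Finset.card_pos.2 hcell.1
    have hcard : cellDim t G = G.card - 1 :=
      cellDim_eq (by omega) (hGscarf.affineIndependent ht)
    have hσcard := σ.2.2
    obtain ⟨α, hα⟩ : ∃ α, σ.1 \ G = {α} := by
      rw [← Finset.card_eq_one, Finset.card_sdiff_of_subset hGσ]
      omega
    have hαmem : α ∈ σ.1 \ G := hα ▸ Finset.mem_singleton_self α
    refine hGimg ⟨⟨α, (Finset.mem_sdiff.1 hαmem).1⟩, Finset.mem_coe.2 (Finset.mem_attach _ _), ?_⟩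
    simp only
    rw [Finset.erase_eq, ← hα, Finset.sdiff_sdiff_eq_self hGσ]
  · intro α _
    have hG : σ.1.erase α.1 ∈ hullCells t A ∧ cellDim t (σ.1.erase α.1) = i :=
      ((σ.erase α).toHullCell ht).2
    rw [dif_pos hG, Finsupp.smul_single, smul_eq_mul]
    rfl

theorem scarfToHull_taylorD {n : ℕ} (k : Type*) [Field k] {A : Set (Fin n → ℤ)} {t : ℝ}
    (ht : ((n + 1).factorial : ℝ) < t) (o : CellOrientation n t) (i : ℕ)
    (x : TaylorModule k (scarfComplex A) (i + 1)) :
    scarfToHull k ht o i (taylorD k (scarfComplex A) i x) =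
      hullD k A o i (scarfToHull k ht o (i + 1) x) := by
  suffices h : (scarfToHull k ht o i).comp (taylorD k (scarfComplex A) i) =
      (hullD k A o i).comp (scarfToHull k ht o (i + 1)) from LinearMap.congr_fun h x
  refine Finsupp.lhom_ext' fun σ => LinearMap.ext_ring ?_
  rw [LinearMap.comp_apply, LinearMap.comp_apply, LinearMap.comp_apply, LinearMap.comp_apply,
    Finsupp.lsingle_apply, scarfToHull_single, hullD_single_toHullCell, taylorD,
    Finsupp.linearCombination_single, one_smul, map_sum]
  refine Finset.sum_congr rfl fun α _ => ?_
  rw [scarfToHull_single, one_mul]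
  congr 1
  have h := congrArg (Int.cast : ℤ → k) (orientationUnit_mul_incidence ht o σ α
    (σ.cellDim_eq_cellDim_erase_add_one ht α))
  rw [Int.cast_mul, Int.cast_mul, Int.cast_pow, Int.cast_neg, Int.cast_one] at h
  rw [← map_intCast (MvPolynomial.C (σ := Fin n) (R := k)),
    ← map_intCast (MvPolynomial.C (σ := Fin n) (R := k)), MvPolynomial.C_mul_monomial, mul_comm,
    MvPolynomial.C_mul_monomial, h, mul_comm]

theorem mainTheorem5 {n : ℕ} (k : Type*) [Field k] (A : Set (Fin n → ℤ)) (t : ℝ)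
    (ht : ((n + 1).factorial : ℝ) < t) (o : CellOrientation n t) :
    (∀ σ ∈ scarfComplex A,
      AffineIndependent ℝ (fun α : σ => expPoint t α.1) ∧
      IsExposed ℝ (hullPolyhedron t A) (cellBody t σ) ∧
      σ ∈ hullCells t A ∧
      ∀ τ ∈ hullCells t A, cellBody t τ ⊆ cellBody t σ → τ ∈ scarfComplex A) ∧
    ∃ (P : ∀ i, Submodule (MvPolynomial (Fin n) k) (HullModule k t A i))
      (e : ∀ i, TaylorModule k (scarfComplex A) i ≃ₗ[MvPolynomial (Fin n) k] P i),
      (∀ i, ∀ x ∈ P (i + 1), hullD k A o i x ∈ P i) ∧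
      (∀ i x, (e i (taylorD k (scarfComplex A) i x) : HullModule k t A i) =
        hullD k A o i (e (i + 1) x)) ∧
      ∀ i (σ : SimplexOfDim (scarfComplex A) i), ∃ (F : HullCellOfDim t A i) (u : ℤˣ),
        F.1 = σ.1 ∧ (e i (Finsupp.single σ 1) : HullModule k t A i) =
          Finsupp.single F (((u : ℤ) : MvPolynomial (Fin n) k)) := by
  refine ⟨fun σ hσ => ⟨StronglyNeighborly.affineIndependent ht hσ,
    StronglyNeighborly.isExposed_cellBody ht hσ, StronglyNeighborly.mem_hullCells ht hσ,
    fun τ hτ h => StronglyNeighborly.of_cellBody_subset ht hσ hτ h⟩, ?_⟩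
  refine ⟨fun i => LinearMap.range (scarfToHull k ht o i),
    fun i => LinearEquiv.ofInjective _ (scarfToHull_injective k ht o i), ?_, ?_, ?_⟩
  · rintro i _ ⟨y, rfl⟩
    exact ⟨taylorD k (scarfComplex A) i y, scarfToHull_taylorD k ht o i y⟩
  · exact fun i x => scarfToHull_taylorD k ht o i x
  · refine fun i σ => ⟨σ.toHullCell ht, orientationUnit ht o σ, rfl, ?_⟩
    exact (scarfToHull_single k ht o σ 1).trans (by rw [one_mul])
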